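/- Let $\Lambda=\mathbb{C}[p_1,p_2,\dots]$ be bosonic Fock space, with operators $J_n=n\,\partial/\partial p_n$ and $J_{-n}=p_n\cdot$ for $n>0$, and write $\langle P\rangle$ for the value of $P(1)$ at $p_1=p_2=\dots=0$. Put $\varsigma(u)=2\sinh(u/2)$ and define $\mathcal{E}_n(u)$, $n\in\mathbb{Z}$, by $$\sum_{n\in\mathbb{Z}} z^n\,\mathcal{E}_n(u)=\frac{1}{\varsigma(u)}\exp\Big(\sum_{j\ge1}\varsigma(uj)\frac{J_{-j}}{j}z^{-j}\Big)\exp\Big(\sum_{j\ge1}\varsigma(uj)\frac{J_{j}}{j}z^{j}\Big).$$ For $k>0$ define the $k$-leaky $r$-completed cycles cut-and-join operators $\mathcal{F}_r^k$ by $\mathcal{E}_{-k}(u)=\sum_{r\ge0}\mathcal{F}_r^k\,\frac{u^r}{r!}$. For positive integers $r,k,q$, an integer $g\ge 0$ and a partition $\mu$, the genus-$g$ orbifold leaky completed cycles Hurwitz number is $$\mathrm{lh}^{k,r,q}_{g;\mu}=\frac{1}{|\mathrm{Aut}\,\mu|\,|\mathrm{Aut}\,\nu|\,\prod_i\mu_i\,\prod_j\nu_j}\Big\langle\prod_i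 J_{\mu_i}\Big(\frac{\mathcal{F}_r^k}{r}\Big)^{s}\prod_j J_{-\nu_j}\Big\rangle,\qquad \nu=(q^n),$$ where the integers $s,n\ge0$ are determined by $s(r-1)=2g-2+\ell(\mu)+n$ and $|\mu|=qn+ks$ (there is at most one such pair), and $\mathrm{lh}^{k,r,q}_{g;\mu}=0$ if there is no such pair. (For $\ell(\mu)=1$ the connected and the not necessarily connected numbers coincide.) **Theorem.** Let $r,k,m,q$ be positive integers and define $A=\frac{k}{r}$. Then $\mathrm{lh}^{k,r,q}_{0;(m)}$ is non-zero if and only if $b=\frac{m-q}{q(r-1)+k}$ is a non-negative integer, and in that case $$\mathrm{lh}^{k,r,q}_{0;(m)}=\frac{b!}{m(b(r-1)+1)}\binom{\frac{m}{A}}{b}A^b,$$ where $\binom{x}{b}=\frac{x(x-1)\cdots(x-b+1)}{b!}$. -/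

import Mathlib

open scoped Nat

noncomputable section

namespace LeakyHurwitz

/-- Charge-zero bosonic Fock space: the ring of symmetric functions over `ℂ`, as the polynomial
ring freely generated by the power sums `p₁, p₂, …`. -/
abbrev Fock : Type := MvPolynomial ℕ+ ℂ

/-- The Heisenberg operators on Fock space: for `n > 0`, `J n = n ∂/∂pₙ` and `J (-n)` is
multiplication by `pₙ`; the charge `J 0` acts by zero. -/
def J : ℤ → Module.End ℂ Fock
  | .ofNat 0 => 0
  | .ofNat (n + 1) => ((n + 1 : ℕ) : ℂ) • (MvPolynomial.pderiv n.succPNat).toLinearMap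
  | .negSucc n => LinearMap.mulLeft ℂ (MvPolynomial.X n.succPNat)

/-- The vacuum expectation value `⟨P⟩ = ⟨0| P |0⟩`: the vacuum is `1`, and the covacuum sends a
polynomial in the `pₙ` to its value at `p = 0`. -/
def vev (P : Module.End ℂ Fock) : ℂ := MvPolynomial.constantCoeff (P 1)

/-- The power series `ς(cu) = 2 sinh(cu/2) = exp(cu/2) - exp(-cu/2)` in `u`. -/
def varsigma (c : ℂ) : PowerSeries ℂ :=
  PowerSeries.rescale (c / 2) (PowerSeries.exp ℂ) - PowerSeries.rescale (-c / 2) (PowerSeries.exp ℂ)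

/-- The power series `𝒮(u) = ς(u) / u`. -/
def calS : PowerSeries ℂ := PowerSeries.mk fun n => PowerSeries.coeff (n + 1) (varsigma 1)

/-- The product `∏ᵢ ς(cᵢ u) / cᵢ` over the parts of a composition. -/
def sigmaProd {n : ℕ} (c : Composition n) : PowerSeries ℂ :=
  (c.blocks.map fun j : ℕ => (j : ℂ)⁻¹ • varsigma j).prod

/-- `∏ᵢ J (cᵢ)` over the parts of a composition. -/
def annih {n : ℕ} (c : Composition n) : Module.End ℂ Fock :=
  (c.blocks.map fun j : ℕ => J (j : ℤ)).prod

/-- `∏ᵢ J (-cᵢ)` over the parts of a composition. -/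
def creat {n : ℕ} (c : Composition n) : Module.End ℂ Fock :=
  (c.blocks.map fun j : ℕ => J (-(j : ℤ))).prod

/-- On Fock space, the operator `𝓔ₙ(u)` is the coefficient of `z ^ n` in the vertex operator
`ς(u)⁻¹ exp(∑_{j ≥ 1} ς(uj) J₋ⱼ z⁻ʲ / j) exp(∑_{j ≥ 1} ς(uj) Jⱼ zʲ / j)`.
Here is `r!` times the coefficient of `u ^ r` in the part of `𝓔₋ₖ(u)` which is obtained by choosing
`z ^ a` in the second exponential and `z ^ (-(a + k))` in the first one. We use that
`[z ^ a] exp(∑_{j ≥ 1} xⱼ zʲ) = ∑_c x_{c₁} ⋯ x_{c_ℓ} / ℓ!`, the sum being over the compositions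
`c = (c₁, …, c_ℓ)` of `a`, and that
`[u ^ r] (P(u) / ς(u)) = [u ^ (r + 1)] (P(u) / 𝒮(u))`. -/
def cutJoinPart (k r a : ℕ) : Module.End ℂ Fock :=
  ∑ c : Composition (a + k), ∑ d : Composition a,
    ((r ! : ℂ) * PowerSeries.coeff (r + 1) (sigmaProd c * sigmaProd d * calS⁻¹) /
      ((c.length ! : ℂ) * (d.length ! : ℂ))) • (creat c * annih d)

theorem J_monomial (n : ℕ) (e : ℕ+ →₀ ℕ) (x : ℂ) :
    J ((n + 1 : ℕ) : ℤ) (MvPolynomial.monomial e x) =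
      ((n + 1 : ℕ) : ℂ) • MvPolynomial.monomial (e - Finsupp.single n.succPNat 1)
        (x * (e n.succPNat : ℂ)) := by
  change ((n + 1 : ℕ) : ℂ) • (MvPolynomial.pderiv n.succPNat (MvPolynomial.monomial e x)) = _
  rw [MvPolynomial.pderiv_monomial]

theorem prod_J_monomial_eq_zero (l : List ℕ) (hl : ∀ j ∈ l, 0 < j) :
    ∀ (e : ℕ+ →₀ ℕ) (x : ℂ), (e.sum fun i m => m * (i : ℕ)) < l.sum →
      (l.map fun j : ℕ => J (j : ℤ)).prod (MvPolynomial.monomial e x) = 0 := by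
  induction l using List.reverseRecOn with
  | nil => intro e x h; simp at h
  | append_singleton l j ih =>
    intro e x h
    obtain ⟨n, rfl⟩ : ∃ n, j = n + 1 := ⟨j - 1, by have := hl j (by simp); omega⟩
    rw [List.map_append, List.prod_append, List.map_singleton, List.prod_singleton,
      Module.End.mul_apply, J_monomial, map_smul]
    by_cases h0 : e n.succPNat = 0
    · simp [h0]
    · rw [ih (fun j hj => hl j (by simp [hj])), smul_zero]
      have hle : Finsupp.single n.succPNat 1 ≤ e := by
        rw [Finsupp.single_le_iff]; omega
      have key : (e.sum fun i m => m * (i : ℕ)) =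
          ((e - Finsupp.single n.succPNat 1).sum fun i m => m * (i : ℕ)) + (n + 1) := by
        conv_lhs => rw [← tsub_add_cancel_of_le hle]
        rw [Finsupp.sum_add_index' (by simp) (by intros; ring), Finsupp.sum_single_index (by simp)]
        simp
      rw [List.sum_append, List.sum_singleton] at h
      omega

/-- Only finitely many of the operators `cutJoinPart k r a` act non-trivially on a given vector. -/
theorem finite_support_cutJoinPart (k r : ℕ) (f : Fock) :
    (Function.support fun a => cutJoinPart k r a f).Finite := by
  refine (Set.finite_Iic (f.support.sup fun e => e.sum fun i m => m * (i : ℕ))).subset ?_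
  intro a ha
  by_contra hlt
  rw [Set.mem_Iic, not_le] at hlt
  refine ha ?_
  have hann : ∀ d : Composition a, annih d f = 0 := by
    intro d
    rw [f.as_sum, map_sum]
    refine Finset.sum_eq_zero fun e he => prod_J_monomial_eq_zero _ (fun j hj => d.blocks_pos hj) _ _ ?_
    rw [d.blocks_sum]
    exact lt_of_le_of_lt (Finset.le_sup (f := fun e : ℕ+ →₀ ℕ => e.sum fun i m => m * (i : ℕ)) he) hlt
  simp [cutJoinPart, LinearMap.sum_apply, hann]

/-- The `k`-leaky `r`-completed cycles cut-and-join operator `𝓕ᵣᵏ` for `k ≥ 0`, defined by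
`𝓔₋ₖ(u) = ∑ᵣ 𝓕ᵣᵏ uʳ / r!`. The sum over `a` is finite on every vector. -/
def cutJoin (k r : ℕ) : Module.End ℂ Fock where
  toFun f := ∑ᶠ a : ℕ, cutJoinPart k r a f
  map_add' f g := by
    simp only [map_add]
    exact finsum_add_distrib (finite_support_cutJoinPart k r f) (finite_support_cutJoinPart k r g)
  map_smul' x f := by
    simp only [map_smul, RingHom.id_apply]
    exact (smul_finsum' x (finite_support_cutJoinPart k r f)).symm

/-- The order of the automorphism group of a partition, given as the list of its parts. -/
def autCard (μ : List ℕ) : ℕ := ∏ a ∈ μ.toFinset, (μ.count a)!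

/-- The completed cycles leaky Hurwitz number with left profile `μ`, right profile `ν` (lists of
positive integers) and `s` vertices, all of them `k`-leaky and `r`-completed:
`1 / (|Aut μ| |Aut ν| ∏ μᵢ ∏ νⱼ) · ⟨∏ J_{μᵢ} (𝓕ᵣᵏ / r) ^ s ∏ J_{-νⱼ}⟩`. -/
def leakyHurwitz (k r s : ℕ) (μ ν : List ℕ) : ℂ :=
  vev ((μ.map fun a : ℕ => J (a : ℤ)).prod * ((r : ℂ)⁻¹ • cutJoin k r) ^ s *
      (ν.map fun a : ℕ => J (-(a : ℤ))).prod) /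
    ((autCard μ : ℂ) * (autCard ν : ℂ) * (μ.prod : ℂ) * (ν.prod : ℂ))

/-- The genus `g` orbifold leaky completed cycles Hurwitz number `lh^{k,r,q}_{g;μ}`, for `k, q ≥ 1`:
the number of the previous definition with `ν = (q, …, q)`, where the length `n` of `ν` and the
number `s` of vertices are determined by `s (r - 1) = 2 g - 2 + ℓ(μ) + n` (Riemann-Hurwitz) and
`|μ| = |ν| + s k`. For `k, q ≥ 1` there is at most one such pair `(s, n)`, and it satisfies
`s, n ≤ |μ|`; if there is none, the number is zero. -/
def orbifoldLeakyHurwitz (k r q g : ℕ) (μ : List ℕ) : ℂ :=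
  ∑ x ∈ (Finset.range (μ.sum + 1) ×ˢ Finset.range (μ.sum + 1)).filter (fun x : ℕ × ℕ =>
      (x.1 : ℤ) * ((r : ℤ) - 1) = 2 * (g : ℤ) - 2 + (μ.length : ℤ) + (x.2 : ℤ) ∧
        μ.sum = q * x.2 + k * x.1),
    leakyHurwitz k r x.1 μ (List.replicate x.2 q)

end LeakyHurwitz

end

/-! Put ρ = r - 1 and grade Fock space by polynomial degree, that is, by the number of parts. Since
ς(ju)/j = u + O(u²), a term of the cut-and-join operator with ℓ(c) creators and ℓ(d) annihilators
survives only if ℓ(c) + ℓ(d) ≤ ρ + 2. As leakage forces ℓ(c) ≥ 1, the degree drops by at most ρ, and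
by exactly ρ only when ρ + 1 parts merge into one (`cutJoinPart_sub_mem`). In genus zero, b vertices
must bring p_q^(ρb+1) down to degree 1, so each of them acts through this merging part alone.

The merging part is diagonalised by powers of W = ∑ (s_d/d) p_d X^d. Each J_d with d > 0 is a
derivation with J_d W = s_d X^d, so merging sends a coefficient of W^(l+1+ρ) to a multiple of one of
W^(l+1), provided that S = ∑ s_d X^d satisfies a first-order equation linking S to S^(ρ+1)
(`cutJoin_coeff_linearSeries_pow_sub_mem`). The solution starting with q X^q counts weighted trees.
Its coefficients are Hagen–Rothe numbers, because their convolution identity (`hagenRothe_add`)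
makes all powers of S explicit (`treeSeries_equation`). Iteration gives `cutJoin_pow_sub_mem`, from
which the number is read off. It is non-zero because every factor of the Hagen–Rothe product is
positive. -/

namespace LeakyHurwitz

open Finset PowerSeries

/-! ### Hagen–Rothe numbers and their convolution -/

/-- The rising Hagen–Rothe numbers `x / (x + n z) * ((x + n z)(x + n z + 1)⋯(x + n z + n - 1)) / n!`,
written without the removable denominator. -/
noncomputable def hagenRothe (z : ℂ) : ℕ → ℂ → ℂ
  | 0, _ => 1
  | n + 1, x => x * (∏ i ∈ range n, (x + (n + 1) * z + (i + 1))) / (n + 1)!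

theorem hagenRothe_zero (z x : ℂ) : hagenRothe z 0 x = 1 := rfl

theorem hagenRothe_zero_right (z : ℂ) (n : ℕ) : hagenRothe z n 0 = if n = 0 then 1 else 0 := by
  cases n <;> simp [hagenRothe]

/-- A Pascal rule: it drives the induction on n in the convolution identity. -/
theorem hagenRothe_add_one (z : ℂ) (n : ℕ) (x : ℂ) :
    hagenRothe z (n + 1) (x + 1) = hagenRothe z (n + 1) x + hagenRothe z n (x + 1 + z) := by
  cases n with
  | zero => simp [hagenRothe]
  | succ n =>
    simp only [hagenRothe]
    rw [prod_range_succ (n := n), prod_range_succ' (n := n)]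
    have h1 : ∏ i ∈ range n, (x + 1 + ((n + 1 : ℕ) + 1) * z + ((i : ℂ) + 1)) =
        ∏ i ∈ range n, (x + 1 + z + ((n : ℂ) + 1) * z + (i + 1)) :=
      prod_congr rfl fun i _ => by push_cast; ring
    have h2 : ∏ i ∈ range n, (x + ((n + 1 : ℕ) + 1) * z + (((i + 1 : ℕ) : ℂ) + 1)) =
        ∏ i ∈ range n, (x + 1 + z + ((n : ℂ) + 1) * z + (i + 1)) :=
      prod_congr rfl fun i _ => by push_cast; ring
    rw [h1, h2, Nat.factorial_succ (n + 1)]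
    generalize ∏ i ∈ range n, (x + 1 + z + ((n : ℂ) + 1) * z + (i + 1)) = P
    have hf : ((n + 1)! : ℂ) ≠ 0 := by exact_mod_cast Nat.factorial_ne_zero _
    have hn : (n : ℂ) + 1 + 1 ≠ 0 := by exact_mod_cast Nat.succ_ne_zero (n + 1)
    push_cast
    field_simp
    ring

theorem exists_polynomial_hagenRothe (z : ℂ) (n : ℕ) :
    ∃ P : Polynomial ℂ, ∀ x, P.eval x = hagenRothe z n x := by
  cases n with
  | zero => exact ⟨1, fun x => by simp [hagenRothe]⟩
  | succ n =>
    refine ⟨Polynomial.C (((n + 1)! : ℂ)⁻¹) * (Polynomial.X * ∏ i ∈ range n,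
      (Polynomial.X + Polynomial.C (((n : ℂ) + 1) * z) + Polynomial.C ((i : ℂ) + 1))), fun x => ?_⟩
    simp only [hagenRothe, Polynomial.eval_mul, Polynomial.eval_C, Polynomial.eval_X,
      Polynomial.eval_prod, Polynomial.eval_add]
    rw [div_eq_inv_mul]

/-- The Hagen–Rothe convolution identity. -/
theorem hagenRothe_add (z : ℂ) (n : ℕ) : ∀ x y : ℂ,
    ∑ p ∈ antidiagonal n, hagenRothe z p.1 x * hagenRothe z p.2 y = hagenRothe z n (x + y) := by
  induction n with
  | zero => intro x y; simp [hagenRothe]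
  | succ n ih =>
    intro x y
    choose P hP using exists_polynomial_hagenRothe z
    -- For fixed y the defect Q of the identity is a polynomial in x. It has period 1 and vanishes
    -- at 0, hence at every natural number, so it is zero.
    set Q : Polynomial ℂ := ∑ p ∈ antidiagonal (n + 1), P p.1 * Polynomial.C (hagenRothe z p.2 y) -
      (P (n + 1)).comp (Polynomial.X + Polynomial.C y) with hQ
    have hQe : ∀ x, Q.eval x = ∑ p ∈ antidiagonal (n + 1),
        hagenRothe z p.1 x * hagenRothe z p.2 y - hagenRothe z (n + 1) (x + y) := by
      intro x
      simp [hQ, Polynomial.eval_finsetSum, hP]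
    have hstep : ∀ x, Q.eval (x + 1) = Q.eval x := by
      intro x
      -- The term with first index 0 does not depend on x; on the others the Pascal rule leaves an
      -- error that the induction hypothesis sums at x + 1 + z.
      rw [hQe, hQe, Nat.sum_antidiagonal_succ, Nat.sum_antidiagonal_succ]
      simp only [hagenRothe_zero]
      simp only [hagenRothe_add_one, add_mul, sum_add_distrib, ih]
      rw [show x + 1 + y = x + y + 1 by ring, hagenRothe_add_one,
        show x + 1 + z + y = x + y + 1 + z by ring]
      ring
    have hzero : ∀ N : ℕ, Q.eval (N : ℂ) = 0 := by
      intro N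
      induction N with
      | zero =>
        rw [hQe, Nat.antidiagonal_succ]
        simp [hagenRothe_zero_right]
      | succ N ihN => rw [Nat.cast_succ, hstep, ihN]
    have : Q = 0 := by
      refine Polynomial.eq_zero_of_infinite_isRoot Q
        ((Set.infinite_range_of_injective (Nat.cast_injective (R := ℂ))).mono ?_)
      rintro _ ⟨N, rfl⟩
      exact hzero N
    have h := hQe x
    rw [this, Polynomial.eval_zero] at h
    exact (sub_eq_zero.mp h.symm)

theorem eval_ascPochhammer_eq_prod (x : ℂ) (n : ℕ) :
    (ascPochhammer ℂ n).eval x = ∏ i ∈ range n, (x + i) := by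
  induction n with
  | zero => simp
  | succ n ih => rw [ascPochhammer_succ_eval, ih, prod_range_succ]

theorem mul_choose_eq_hagenRothe (g : ℂ) (ρ b : ℕ) :
    Ring.choose (g * (b * ρ + 1) + b - 1) b = (b * ρ + 1) * hagenRothe (g * ρ) b g := by
  rw [← Ring.multichoose_eq]
  have h := Ring.factorial_nsmul_multichoose_eq_ascPochhammer (g * (b * ρ + 1) : ℂ) b
  have hf : (b ! : ℂ) ≠ 0 := by exact_mod_cast Nat.factorial_ne_zero _
  rw [nsmul_eq_mul, Polynomial.ascPochhammer_smeval_eq_eval, eval_ascPochhammer_eq_prod] at h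
  rw [← mul_right_inj' hf, h]
  cases b with
  | zero => simp [hagenRothe]
  | succ b =>
    -- The factor i = 0 of the rising product is g(bρ + 1); it supplies both the factor bρ + 1 and
    -- the leading g of the Hagen–Rothe number.
    rw [prod_range_succ', hagenRothe]
    have : ∏ i ∈ range b, (g * (((b + 1 : ℕ) : ℂ) * ρ + 1) + ((i + 1 : ℕ) : ℂ)) =
        ∏ i ∈ range b, (g + ((b : ℂ) + 1) * (g * ρ) + (i + 1)) :=
      prod_congr rfl fun i _ => by push_cast; ring
    rw [this]
    field_simp
    push_cast
    ring

/-- The power series whose coefficients are Hagen–Rothe numbers. -/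
noncomputable def hagenRotheSeries (z x : ℂ) : PowerSeries ℂ := PowerSeries.mk fun n => hagenRothe z n x

theorem hagenRotheSeries_mul (z x y : ℂ) :
    hagenRotheSeries z x * hagenRotheSeries z y = hagenRotheSeries z (x + y) := by
  ext n
  simp [hagenRotheSeries, coeff_mul, hagenRothe_add]

theorem hagenRotheSeries_pow (z x : ℂ) (n : ℕ) :
    hagenRotheSeries z x ^ n = hagenRotheSeries z (n * x) := by
  induction n with
  | zero =>
    ext n
    simp [hagenRotheSeries, hagenRothe_zero_right, coeff_one]
  | succ n ih =>
    rw [pow_succ, ih, hagenRotheSeries_mul]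
    push_cast
    ring_nf

/-- Both sides contain the same product up to its last factor. This is the coefficientwise form of
the tree equation below. -/
theorem hagenRothe_rec (g : ℂ) (ρ b : ℕ) :
    ((b : ℂ) + 1) * hagenRothe (g * ρ) (b + 1) g * ((ρ : ℂ) + 1) =
      (g * (ρ + 1 + b * ρ) + b) * hagenRothe (g * ρ) b ((ρ + 1 : ℕ) * g) := by
  cases b with
  | zero => simp [hagenRothe]
  | succ b =>
    simp only [hagenRothe]
    rw [prod_range_succ, Nat.factorial_succ (b + 1)]
    have : ∏ i ∈ range b, (g + (((b + 1 : ℕ) : ℂ) + 1) * (g * ρ) + (i + 1)) =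
        ∏ i ∈ range b, (((ρ + 1 : ℕ) : ℂ) * g + ((b : ℂ) + 1) * (g * ρ) + (i + 1)) :=
      prod_congr rfl fun i _ => by push_cast; ring
    rw [this]
    generalize ∏ i ∈ range b, (((ρ + 1 : ℕ) : ℂ) * g + ((b : ℂ) + 1) * (g * ρ) + (i + 1)) = P
    have hf : ((b + 1)! : ℂ) ≠ 0 := by exact_mod_cast Nat.factorial_ne_zero _
    have hn : (b : ℂ) + 1 + 1 ≠ 0 := by exact_mod_cast Nat.succ_ne_zero (b + 1)
    push_cast
    field_simp
    ring

/-! ### The tree series and its equation -/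

/-- The weighted generating series of rooted trees with `(ρ + 1)`-ary vertices of leakage `k` and
leaves of weight `q`. -/
noncomputable def treeSeries (ρ k q : ℕ) (h : q * ρ + k ≠ 0) : PowerSeries ℂ :=
  (q : ℂ) • (X ^ q * expand (q * ρ + k) h (rescale ((k : ℂ) / (ρ + 1) * q ^ ρ)
    (hagenRotheSeries ((q * (ρ + 1) / k + 1) * ρ) (q * (ρ + 1) / k + 1))))

theorem coeff_X_pow_mul_expand (κ q : ℕ) (hκ : κ ≠ 0) (f : PowerSeries ℂ) (d : ℕ) :
    coeff d (X ^ q * expand κ hκ f) =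
      if q ≤ d ∧ κ ∣ d - q then coeff ((d - q) / κ) f else 0 := by
  rw [coeff_X_pow_mul', coeff_expand]
  split_ifs <;> simp_all

theorem treeSeries_pow (ρ k q : ℕ) (h : q * ρ + k ≠ 0) (n : ℕ) :
    treeSeries ρ k q h ^ n = ((q : ℂ) ^ n) • (X ^ (q * n) * expand (q * ρ + k) h
      (rescale ((k : ℂ) / (ρ + 1) * q ^ ρ)
    (hagenRotheSeries ((q * (ρ + 1) / k + 1) * ρ) (n * (q * (ρ + 1) / k + 1))))) := by
  rw [treeSeries, smul_pow, mul_pow, ← pow_mul, ← map_pow, ← map_pow, hagenRotheSeries_pow]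

theorem coeff_treeSeries (ρ k q : ℕ) (h : q * ρ + k ≠ 0) (b : ℕ) :
    coeff (q + (q * ρ + k) * b) (treeSeries ρ k q h) =
      (q : ℂ) * (((k : ℂ) / (ρ + 1) * q ^ ρ) ^ b *
        hagenRothe ((q * (ρ + 1) / k + 1) * ρ) b (q * (ρ + 1) / k + 1)) := by
  rw [treeSeries, map_smul, coeff_X_pow_mul_expand, if_pos ⟨by omega, by simp⟩, Nat.add_sub_cancel_left,
    Nat.mul_div_cancel_left _ (Nat.pos_of_ne_zero h), coeff_rescale, hagenRotheSeries, coeff_mk,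
    smul_eq_mul]

theorem coeff_treeSeries_eq_zero (ρ k q : ℕ) (h : q * ρ + k ≠ 0) (d : ℕ) (hd : d ≠ q)
    (hlt : d < k ∨ d < q) : coeff d (treeSeries ρ k q h) = 0 := by
  rw [treeSeries, map_smul, coeff_X_pow_mul_expand, if_neg, smul_zero]
  rintro ⟨h1, h2⟩
  have := Nat.le_of_dvd (by omega) h2
  have : k ≤ q * ρ + k := Nat.le_add_left _ _
  omega

/-- The exponents of S are q + κb with κ = qρ + k, and those of S^(ρ+1) are q(ρ+1) + κb; adding k to
the latter gives q + κ(b+1). There a + k - q = κ(b+1), so the equation becomes `hagenRothe_rec`. At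
a + k = q the right side vanishes, which leaves the initial coefficient of S free. -/
theorem treeSeries_equation (ρ k q : ℕ) (hk : 0 < k) (h : q * ρ + k ≠ 0) (a : ℕ) :
    (((q * ρ + k : ℕ) : ℂ) / (ρ + 1)) * coeff a (treeSeries ρ k q h ^ (ρ + 1)) =
      ((a : ℂ) + k - q) * (coeff (a + k) (treeSeries ρ k q h) / (a + k)) := by
  by_cases hd : q * (ρ + 1) ≤ a ∧ (q * ρ + k) ∣ a - q * (ρ + 1)
  · obtain ⟨h1, b, hb⟩ := hd
    have ha : a = q * (ρ + 1) + (q * ρ + k) * b := by omega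
    have hak : a + k = q + (q * ρ + k) * (b + 1) := by rw [ha]; ring
    have hkc : (k : ℂ) ≠ 0 := by exact_mod_cast hk.ne'
    have hρ : (ρ : ℂ) + 1 ≠ 0 := by exact_mod_cast Nat.succ_ne_zero ρ
    rw [hak, coeff_treeSeries, treeSeries_pow, map_smul, coeff_X_pow_mul_expand,
      if_pos ⟨h1, b, hb⟩, hb, Nat.mul_div_cancel_left _ (Nat.pos_of_ne_zero h), coeff_rescale,
      hagenRotheSeries, coeff_mk, smul_eq_mul]
    have hrec := hagenRothe_rec ((q : ℂ) * (ρ + 1) / k + 1) ρ b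
    set g : ℂ := (q : ℂ) * (ρ + 1) / k + 1 with hg
    have hac : (a : ℂ) + k = q + (q * ρ + k) * (b + 1) := by exact_mod_cast hak
    have hne : (q : ℂ) + (q * ρ + k) * (b + 1) ≠ 0 := by
      rw [← hac]; exact_mod_cast (by omega : a + k ≠ 0)
    -- This identity dictates the parameter g = q(ρ+1)/k + 1: the factor in the recurrence has to
    -- become a multiple of a + k.
    have hgk : (g * (ρ + 1 + b * ρ) + b) * ((k : ℂ) / (ρ + 1)) = q + (q * ρ + k) * (b + 1) := by
      rw [hg]; field_simp; ring
    rw [hac]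
    generalize hagenRothe (g * ρ) (b + 1) g = R1 at *
    generalize hagenRothe (g * ρ) b ((ρ + 1 : ℕ) * g) = R0 at *
    have hR : ((b : ℂ) + 1) * R1 * k = (q + (q * ρ + k) * (b + 1)) * R0 := by
      rw [← hgk]
      have : ((b : ℂ) + 1) * R1 * k = (((b : ℂ) + 1) * R1 * (ρ + 1)) * (k / (ρ + 1)) := by
        field_simp
      rw [this, hrec]; ring
    have hc : (k : ℂ) / (ρ + 1) * q ^ ρ * (ρ + 1) = k * q ^ ρ := by field_simp
    generalize (k : ℂ) / (ρ + 1) * q ^ ρ = c at *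
    rw [← mul_div_assoc, div_mul_eq_mul_div, div_eq_div_iff hρ hne]
    push_cast
    linear_combination (-((q : ℂ) * ρ + k) * q ^ ρ * q * c ^ b) * hR -
      ((q : ℂ) * ρ + k) * (b + 1) * q * c ^ b * R1 * hc
  · rw [treeSeries_pow, map_smul, coeff_X_pow_mul_expand, if_neg hd, smul_zero, mul_zero]
    by_cases hq : a + k = q
    · rw [show (a : ℂ) + k - q = 0 by rw [← hq]; push_cast; ring, zero_mul]
    · rw [treeSeries, map_smul, coeff_X_pow_mul_expand, if_neg, smul_zero, zero_div, mul_zero]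
      rintro ⟨h1, c, hc⟩
      obtain _ | c := c
      · omega
      refine hd ⟨?_, c, ?_⟩ <;> rw [mul_add_one] at * <;> omega

/-! ### Compositions and powers of power series -/

/-- Expanding the power gives a sum over r-tuples of exponents; since S has no constant term, only
tuples of positive exponents contribute, and these are the compositions with r parts. -/
theorem sum_composition_prod_coeff (S : PowerSeries ℂ) (hS : constantCoeff S = 0) (r a : ℕ) :
    ∑ d : Composition a with d.length = r, (d.blocks.map fun j => coeff j S).prod =
      coeff a (S ^ r) := by
  rw [coeff_pow]
  have hprod : ∀ d : Composition a, d.length = r →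
      (d.blocks.map fun j => coeff j S).prod =
        ∏ i ∈ range r, coeff (d.blocks.toFinsupp i) S := by
    rintro d rfl
    conv_lhs => rw [← List.ofFn_get d.blocks, List.map_ofFn, List.prod_ofFn]
    rw [← Composition.blocks_length, prod_range]
    refine Finset.prod_congr rfl fun i _ => ?_
    rw [List.toFinsupp_apply, List.getD_eq_getElem _ _ i.2]
    rfl
  refine sum_bij_ne_zero (fun d _ _ => d.blocks.toFinsupp) ?_ ?_ ?_ ?_
  · intro d hd _
    obtain ⟨-, rfl⟩ := mem_filter.mp hd
    rw [mem_finsuppAntidiag]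
    constructor
    · conv_rhs => rw [← d.blocks_sum, ← List.ofFn_get d.blocks, List.sum_ofFn]
      rw [← Composition.blocks_length, sum_range]
      simp
    · intro i hi
      simp only [Finsupp.mem_support_iff, List.toFinsupp_apply] at hi
      rw [mem_range, ← Composition.blocks_length]
      by_contra h
      exact hi (List.getD_eq_default _ _ (not_lt.mp h))
  · intro d hd _ d' hd' _ h
    have h1 : d.blocks.length = d'.blocks.length := by
      rw [Composition.blocks_length, Composition.blocks_length, (mem_filter.mp hd).2,
        (mem_filter.mp hd').2]
    refine Composition.ext (List.ext_getElem h1 fun i hi hi' => ?_)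
    have := DFunLike.congr_fun h i
    simpa [List.getD_eq_getElem, hi, hi'] using this
  · intro l hl hne
    rw [mem_finsuppAntidiag] at hl
    have hpos : ∀ i ∈ range r, 0 < l i := by
      intro i hi
      refine Nat.pos_of_ne_zero fun h0 => prod_ne_zero_iff.mp hne i hi ?_
      rw [h0, coeff_zero_eq_constantCoeff, hS]
    let d : Composition a := ⟨List.ofFn fun i : Fin r => l i, by
      intro i hi
      obtain ⟨j, rfl⟩ := (List.mem_ofFn' _ _).mp hi
      exact hpos j (mem_range.mpr j.2), by
      rw [List.sum_ofFn, ← hl.1, sum_range]⟩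
    have hd : d.length = r := by simp [d, Composition.length]
    have hdl : d.blocks.toFinsupp = l := by
      ext i
      by_cases hi : i < r
      · simp [d, hi]
      · have : l i = 0 := by
          by_contra h
          exact hi (mem_range.mp (hl.2 (Finsupp.mem_support_iff.mpr h)))
        simp [d, hi, this]
    refine ⟨d, by simp [hd], ?_, hdl⟩
    rw [hprod d hd, hdl]
    exact hne
  · intro d hd _
    exact hprod d (mem_filter.mp hd).2

/-! ### The leading coefficients of the cut-and-join operators -/

theorem constantCoeff_varsigma (c : ℂ) : constantCoeff (varsigma c) = 0 := by
  rw [← coeff_zero_eq_constantCoeff, varsigma, map_sub, coeff_rescale, coeff_rescale]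
  simp

theorem coeff_one_varsigma (c : ℂ) : coeff 1 (varsigma c) = c := by
  rw [varsigma, map_sub, coeff_rescale, coeff_rescale]
  simp [coeff_exp]
  ring

theorem constantCoeff_calS : constantCoeff calS = 1 := by
  rw [← coeff_zero_eq_constantCoeff, calS, coeff_mk, coeff_one_varsigma]

theorem exists_smul_varsigma_eq (j : ℕ) (hj : 0 < j) :
    ∃ G : PowerSeries ℂ, constantCoeff G = 1 ∧ (j : ℂ)⁻¹ • varsigma j = X * G := by
  obtain ⟨G, hG⟩ := X_dvd_iff.mpr (constantCoeff_varsigma (j : ℂ))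
  have hj' : (j : ℂ) ≠ 0 := by exact_mod_cast hj.ne'
  refine ⟨(j : ℂ)⁻¹ • G, ?_, by rw [hG, mul_smul_comm]⟩
  have h1 := coeff_one_varsigma (j : ℂ)
  rw [hG, ← zero_add 1, coeff_succ_X_mul, coeff_zero_eq_constantCoeff] at h1
  rw [← coeff_zero_eq_constantCoeff, map_smul, coeff_zero_eq_constantCoeff, h1, smul_eq_mul,
    inv_mul_cancel₀ hj']

theorem exists_sigmaProd_eq {n : ℕ} (c : Composition n) :
    ∃ G : PowerSeries ℂ, constantCoeff G = 1 ∧ sigmaProd c = X ^ c.length * G := by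
  have key : ∀ l : List ℕ, (∀ j ∈ l, 0 < j) → ∃ G : PowerSeries ℂ, constantCoeff G = 1 ∧
      (l.map fun j : ℕ => (j : ℂ)⁻¹ • varsigma j).prod = X ^ l.length * G := by
    intro l
    induction l with
    | nil => exact fun _ => ⟨1, by simp, by simp⟩
    | cons j l ih =>
      intro hl
      obtain ⟨G, hG, h⟩ := ih fun i hi => hl i (by simp [hi])
      obtain ⟨G', hG', h'⟩ := exists_smul_varsigma_eq j (hl j (by simp))
      refine ⟨G' * G, by rw [map_mul, hG, hG', one_mul], ?_⟩
      rw [List.map_cons, List.prod_cons, h, h', List.length_cons, pow_succ]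
      ring
  exact key c.blocks fun j hj => c.blocks_pos hj

/-- Each part contributes a factor u(1 + O(u)), and 𝒮 has constant term 1. -/
theorem coeff_sigmaProd_mul {m n : ℕ} (c : Composition m) (d : Composition n) (r : ℕ)
    (h : r ≤ c.length + d.length) :
    coeff r (sigmaProd c * sigmaProd d * calS⁻¹) = if r = c.length + d.length then 1 else 0 := by
  obtain ⟨G, hG, h1⟩ := exists_sigmaProd_eq c
  obtain ⟨G', hG', h2⟩ := exists_sigmaProd_eq d
  rw [h1, h2, show X ^ c.length * G * (X ^ d.length * G') * calS⁻¹ =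
    X ^ (c.length + d.length) * (G * G' * calS⁻¹) by rw [pow_add]; ring, coeff_X_pow_mul']
  split_ifs with h3 h4 h4
  · rw [h4, Nat.sub_self, coeff_zero_eq_constantCoeff]
    simp [hG, hG', constantCoeff_inv, constantCoeff_calS]
  · omega
  · omega
  · rfl

/-! ### The Heisenberg operators and the degree filtration -/

theorem J_natCast_succ (n : ℕ) (f : Fock) :
    J ((n + 1 : ℕ) : ℤ) f = ((n + 1 : ℕ) : ℂ) • MvPolynomial.pderiv n.succPNat f := rfl

theorem J_neg_natCast_succ (n : ℕ) (f : Fock) :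
    J (-((n + 1 : ℕ) : ℤ)) f = MvPolynomial.X n.succPNat * f := rfl

theorem J_natCast_mul (d : ℕ) (hd : 0 < d) (f g : Fock) : J d (f * g) = J d f * g + f * J d g := by
  obtain ⟨n, rfl⟩ : ∃ n, d = n + 1 := ⟨d - 1, by omega⟩
  rw [J_natCast_succ, J_natCast_succ, J_natCast_succ, MvPolynomial.pderiv_mul, smul_add,
    smul_mul_assoc, mul_smul_comm]

theorem J_natCast_one (d : ℕ) : J d (1 : Fock) = 0 := by
  obtain _ | n := d
  · rfl
  · rw [J_natCast_succ, MvPolynomial.pderiv_one, smul_zero]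

theorem J_natCast_J_neg_natCast_one (d e : ℕ) (hd : 0 < d) :
    J d (J (-(e : ℤ)) 1) = if d = e then MvPolynomial.C (d : ℂ) else 0 := by
  obtain ⟨n, rfl⟩ : ∃ n, d = n + 1 := ⟨d - 1, by omega⟩
  obtain _ | k := e
  · rw [if_neg (by omega)]
    exact map_zero _
  · rw [J_neg_natCast_succ, mul_one, J_natCast_succ, MvPolynomial.pderiv_X, Pi.single_apply]
    by_cases h : n = k
    · subst h
      simp [MvPolynomial.smul_eq_C_mul]
    · rw [if_neg, if_neg (by omega), smul_zero]
      intro h'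
      exact h (Nat.succPNat_injective h').symm

theorem J_neg_natCast_eq_mul (e : ℕ) (f : Fock) : J (-(e : ℤ)) f = J (-(e : ℤ)) 1 * f := by
  obtain _ | k := e
  · exact (zero_mul f).symm
  · rw [J_neg_natCast_succ, J_neg_natCast_succ, mul_one]

/-- The ideal of polynomials without terms of degree less than `e`. -/
noncomputable abbrev degGE (e : ℕ) : Ideal Fock := MvPolynomial.idealOfVars ℕ+ ℂ ^ e

theorem degGE_anti {e e' : ℕ} (h : e ≤ e') {f : Fock} (hf : f ∈ degGE e') : f ∈ degGE e :=
  Ideal.pow_le_pow_right h hf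

theorem smul_mem_degGE {e : ℕ} (x : ℂ) {f : Fock} (hf : f ∈ degGE e) : x • f ∈ degGE e := by
  rw [MvPolynomial.smul_eq_C_mul]
  exact Ideal.mul_mem_left _ _ hf

theorem J_neg_natCast_one_mem (d : ℕ) : J (-(d : ℤ)) 1 ∈ degGE 1 := by
  obtain _ | n := d
  · exact zero_mem _
  · rw [J_neg_natCast_succ, mul_one, degGE, pow_one]
    exact Ideal.subset_span ⟨_, rfl⟩

theorem J_neg_natCast_mem {e : ℕ} (d : ℕ) {f : Fock} (hf : f ∈ degGE e) :
    J (-(d : ℤ)) f ∈ degGE (e + 1) := by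
  rw [J_neg_natCast_eq_mul, degGE, add_comm, pow_add, ← degGE]
  exact Ideal.mul_mem_mul (J_neg_natCast_one_mem d) hf

theorem J_natCast_mem {e : ℕ} (d : ℕ) {f : Fock} (hf : f ∈ degGE e) : J d f ∈ degGE (e - 1) := by
  obtain _ | n := d
  · exact zero_mem _
  · rw [J_natCast_succ]
    refine smul_mem_degGE _ ?_
    rw [MvPolynomial.mem_pow_idealOfVars_iff'] at hf ⊢
    intro x hx
    rw [MvPolynomial.coeff_pderiv, hf, zero_mul]
    rw [map_add, Finsupp.degree_single]
    omega

theorem list_J_natCast_mem {e : ℕ} (l : List ℕ) {f : Fock} (hf : f ∈ degGE e) :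
    (l.map fun j : ℕ => J (j : ℤ)).prod f ∈ degGE (e - l.length) := by
  induction l with
  | nil => simpa using hf
  | cons j l ih =>
    rw [List.map_cons, List.prod_cons, Module.End.mul_apply, List.length_cons, ← Nat.sub_sub]
    exact J_natCast_mem j ih

theorem list_J_neg_natCast_mem {e : ℕ} (l : List ℕ) {f : Fock} (hf : f ∈ degGE e) :
    (l.map fun j : ℕ => J (-(j : ℤ))).prod f ∈ degGE (e + l.length) := by
  induction l with
  | nil => simpa using hf
  | cons j l ih =>
    rw [List.map_cons, List.prod_cons, Module.End.mul_apply, List.length_cons, ← add_assoc]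
    exact J_neg_natCast_mem j ih

theorem creat_annih_mem {e m n : ℕ} (c : Composition m) (d : Composition n) {f : Fock}
    (hf : f ∈ degGE e) : creat c (annih d f) ∈ degGE (e - d.length + c.length) :=
  list_J_neg_natCast_mem _ (list_J_natCast_mem _ hf)

/-! ### Annihilation operators on powers of linear series -/

/-- The series `∑ (s_d / d) p_d X ^ d` for `S = ∑ s_d X ^ d`. -/
noncomputable def linearSeries (S : PowerSeries ℂ) : PowerSeries Fock :=
  PowerSeries.mk fun d => (coeff d S / d) • J (-(d : ℤ)) 1

theorem coeff_linearSeries (S : PowerSeries ℂ) (d : ℕ) :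
    coeff d (linearSeries S) = (coeff d S / d) • J (-(d : ℤ)) 1 := coeff_mk _ _

theorem coeff_linearSeries_pow_mem (S : PowerSeries ℂ) (l : ℕ) : ∀ n : ℕ,
    coeff n (linearSeries S ^ l) ∈ degGE l := by
  induction l with
  | zero => intro n; simp [degGE]
  | succ l ih =>
    intro n
    rw [pow_succ, coeff_mul]
    refine sum_mem fun p _ => ?_
    rw [degGE, pow_succ, coeff_linearSeries]
    refine Ideal.mul_mem_mul (ih _) ?_
    simpa using smul_mem_degGE _ (J_neg_natCast_one_mem p.2)

/-- The coefficientwise action of `J d` as a derivation. -/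
noncomputable def coeffwiseJ (d : ℕ) (F : PowerSeries Fock) : PowerSeries Fock :=
  PowerSeries.mk fun n => J d (coeff n F)

theorem coeffwiseJ_mul (d : ℕ) (hd : 0 < d) (F G : PowerSeries Fock) :
    coeffwiseJ d (F * G) = coeffwiseJ d F * G + F * coeffwiseJ d G := by
  ext1 n
  simp only [coeffwiseJ, coeff_mk, coeff_mul, map_add, map_sum, J_natCast_mul d hd, sum_add_distrib]

theorem coeff_complex_smul (n : ℕ) (x : ℂ) (F : PowerSeries Fock) :
    coeff n (x • F) = x • coeff n F := rfl

/-- The weights s_d/d in W cancel the d in J_d. The result contains no p variable, so on powers of W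
the operator J_d acts as s_d X^d times differentiation in W. -/
theorem coeffwiseJ_linearSeries (d : ℕ) (hd : 0 < d) (S : PowerSeries ℂ) :
    coeffwiseJ d (linearSeries S) = coeff d S • X ^ d := by
  ext1 n
  rw [coeffwiseJ, coeff_mk, coeff_linearSeries, map_smul, J_natCast_J_neg_natCast_one d n hd,
    coeff_complex_smul, coeff_X_pow]
  have hd' : (d : ℂ) ≠ 0 := by exact_mod_cast hd.ne'
  by_cases h : d = n
  · subst h
    rw [if_pos rfl, if_pos rfl, MvPolynomial.smul_eq_C_mul, MvPolynomial.smul_eq_C_mul,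
      ← MvPolynomial.C_mul, div_mul_cancel₀ _ hd', mul_one]
  · rw [if_neg h, if_neg (Ne.symm h), smul_zero, smul_zero]

theorem coeffwiseJ_linearSeries_pow (d : ℕ) (hd : 0 < d) (S : PowerSeries ℂ) (l : ℕ) :
    coeffwiseJ d (linearSeries S ^ l) =
      ((l : ℂ) * coeff d S) • (X ^ d * linearSeries S ^ (l - 1)) := by
  induction l with
  | zero =>
    ext1 n
    rw [coeffwiseJ, coeff_mk, pow_zero, coeff_one]
    split_ifs <;> simp [J_natCast_one]
  | succ l ih =>
    rw [pow_succ, coeffwiseJ_mul d hd, ih, coeffwiseJ_linearSeries d hd]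
    obtain _ | l := l
    · simp
    · simp only [Nat.add_sub_cancel, smul_mul_assoc, mul_smul_comm]
      push_cast
      rw [show X ^ d * linearSeries S ^ l * linearSeries S = X ^ d * linearSeries S ^ (l + 1) by
        rw [pow_succ]; ring, mul_comm (linearSeries S ^ (l + 1)), ← add_smul]
      ring_nf

theorem J_coeff_linearSeries_pow (d : ℕ) (hd : 0 < d) (S : PowerSeries ℂ) (l n : ℕ) :
    J d (coeff n (linearSeries S ^ l)) =
      ((l : ℂ) * coeff d S) • coeff n (X ^ d * linearSeries S ^ (l - 1)) := by
  rw [← coeff_complex_smul, ← coeffwiseJ_linearSeries_pow d hd, coeffwiseJ, coeff_mk]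

theorem list_J_coeff_linearSeries_pow (S : PowerSeries ℂ) (l n : ℕ) (L : List ℕ)
    (hL : ∀ j ∈ L, 0 < j) :
    (L.map fun j : ℕ => J (j : ℤ)).prod (coeff n (linearSeries S ^ l)) =
      ((l.descFactorial L.length : ℂ) * (L.map fun j => coeff j S).prod) •
        coeff n (X ^ L.sum * linearSeries S ^ (l - L.length)) := by
  induction L with
  | nil => simp
  | cons j L ih =>
    rw [List.map_cons, List.prod_cons, Module.End.mul_apply, ih fun i hi => hL i (by simp [hi]),
      map_smul, coeff_X_pow_mul', List.map_cons, List.prod_cons, List.sum_cons, List.length_cons,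
      add_comm j, pow_add, mul_assoc, coeff_X_pow_mul', Nat.descFactorial_succ]
    split_ifs
    · rw [J_coeff_linearSeries_pow j (hL j (by simp)), smul_smul, ← Nat.sub_sub]
      push_cast
      ring_nf
    · simp

/-! ### The cut-and-join operator modulo higher degree -/

theorem cutJoin_apply_eq_sum (k r : ℕ) (f : Fock) (M : ℕ) :
    ∃ N, M ≤ N ∧ cutJoin k r f = ∑ a ∈ range N, cutJoinPart k r a f := by
  have hfin := finite_support_cutJoinPart k r f
  refine ⟨max M (hfin.toFinset.sup id + 1), le_max_left _ _, ?_⟩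
  refine finsum_eq_sum_of_support_subset _ fun a ha => ?_
  have : a ≤ hfin.toFinset.sup id := le_sup (f := id) (hfin.mem_toFinset.mpr ha)
  simp only [coe_range, Set.mem_Iio]
  omega

/-- From ℓ(c) + ℓ(d) ≤ ρ + 2 and ℓ(c) ≥ 1, the net loss ℓ(d) - ℓ(c) is at most ρ. Positivity of k is
what excludes the empty c. -/
theorem cutJoinPart_mem (k ρ a : ℕ) (hk : 0 < k) {e : ℕ} {f : Fock} (hf : f ∈ degGE e) :
    cutJoinPart k (ρ + 1) a f ∈ degGE (e - ρ) := by
  rw [cutJoinPart, LinearMap.sum_apply]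
  refine sum_mem fun c _ => ?_
  rw [LinearMap.sum_apply]
  refine sum_mem fun d _ => ?_
  have hc : 0 < c.length := c.length_pos_iff.mpr (by omega)
  rw [LinearMap.smul_apply, Module.End.mul_apply]
  by_cases h : ρ + 1 + 1 < c.length + d.length
  · rw [coeff_sigmaProd_mul c d _ h.le, if_neg h.ne, mul_zero, zero_div, zero_smul]
    exact zero_mem _
  · exact smul_mem_degGE _ (degGE_anti (by omega) (creat_annih_mem c d hf))

theorem cutJoin_mem (k ρ : ℕ) (hk : 0 < k) {e : ℕ} {f : Fock} (hf : f ∈ degGE e) :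
    cutJoin k (ρ + 1) f ∈ degGE (e - ρ) := by
  obtain ⟨N, -, h⟩ := cutJoin_apply_eq_sum k (ρ + 1) f 0
  rw [h]
  exact sum_mem fun a _ => cutJoinPart_mem k ρ a hk hf

/-- Up to terms of higher degree, the cut-and-join operator merges `ρ + 1` parts into one. -/
theorem cutJoinPart_sub_mem (k ρ a : ℕ) (hk : 0 < k) {e : ℕ} {f : Fock} (hf : f ∈ degGE e) :
    cutJoinPart k (ρ + 1) a f - ∑ d : Composition a with d.length = ρ + 1,
      J (-((a + k : ℕ) : ℤ)) (annih d f) ∈ degGE (e - ρ + 1) := by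
  have hak : 0 < a + k := by omega
  have hlead : ∑ d : Composition a with d.length = ρ + 1, J (-((a + k : ℕ) : ℤ)) (annih d f) =
      ∑ c : Composition (a + k), ∑ d : Composition a,
        if c.length = 1 ∧ d.length = ρ + 1 then creat c (annih d f) else 0 := by
    rw [sum_eq_single (Composition.single (a + k) hak), sum_filter]
    · refine sum_congr rfl fun d _ => ?_
      simp [creat, Composition.single_blocks]
    · intro c _ hc
      refine sum_eq_zero fun d _ => if_neg fun h => hc ?_
      exact (Composition.eq_single_iff_length hak).mpr h.1
    · simp
  rw [hlead, cutJoinPart, LinearMap.sum_apply, ← sum_sub_distrib]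
  refine sum_mem fun c _ => ?_
  rw [LinearMap.sum_apply, ← sum_sub_distrib]
  refine sum_mem fun d _ => ?_
  have hc : 0 < c.length := c.length_pos_iff.mpr hak
  rw [LinearMap.smul_apply, Module.End.mul_apply]
  by_cases h : c.length = 1 ∧ d.length = ρ + 1
  · have hf : ((ρ + 1)! : ℂ) ≠ 0 := by exact_mod_cast Nat.factorial_ne_zero _
    -- The factor r! of the cut-and-join operator cancels ℓ(d)! = (ρ + 1)!.
    rw [if_pos h, coeff_sigmaProd_mul c d _ (by omega), if_pos (by omega), h.1, h.2]
    simp [hf]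
  · rw [if_neg h, sub_zero]
    by_cases h' : ρ + 1 + 1 < c.length + d.length
    · rw [coeff_sigmaProd_mul c d _ h'.le, if_neg h'.ne, mul_zero, zero_div, zero_smul]
      exact zero_mem _
    · exact smul_mem_degGE _ (degGE_anti (by omega) (creat_annih_mem c d hf))

theorem sum_annih_coeff_linearSeries_pow (S : PowerSeries ℂ) (hS : constantCoeff S = 0)
    (r a l n : ℕ) :
    ∑ d : Composition a with d.length = r, annih d (coeff n (linearSeries S ^ l)) =
      ((l.descFactorial r : ℂ) * coeff a (S ^ r)) •
        coeff n (X ^ a * linearSeries S ^ (l - r)) := by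
  rw [← sum_composition_prod_coeff S hS, mul_sum, sum_smul]
  refine sum_congr rfl fun d hd => ?_
  rw [annih, list_J_coeff_linearSeries_pow S l n _ fun j hj => d.blocks_pos hj, d.blocks_sum,
    d.blocks_length, (mem_filter.mp hd).2]

/-! ### The Euler operator and a single merging step -/

/-- The series `∑ (d - q) (s_d / d) p_d X ^ d` for `S = ∑ s_d X ^ d`. -/
noncomputable def eulerSeries (q : ℕ) (S : PowerSeries ℂ) : PowerSeries Fock :=
  PowerSeries.mk fun d => (((d : ℂ) - q) * (coeff d S / d)) • J (-(d : ℤ)) 1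

theorem coeff_X_mul_derivative (F : PowerSeries Fock) (n : ℕ) :
    coeff n (X * derivative Fock F) = (n : ℂ) • coeff n F := by
  obtain _ | n := n
  · simp
  · rw [coeff_succ_X_mul, coeff_derivative, MvPolynomial.smul_eq_C_mul, mul_comm]
    simp

theorem eulerSeries_eq (q : ℕ) (S : PowerSeries ℂ) :
    eulerSeries q S = X * derivative Fock (linearSeries S) - (q : ℂ) • linearSeries S := by
  ext1 n
  rw [map_sub, coeff_X_mul_derivative, coeff_complex_smul, coeff_linearSeries, eulerSeries,
    coeff_mk, smul_smul, smul_smul, ← sub_smul, sub_mul]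

/-- The Euler series is (X d/dX - q)W, so (l+1) times its product with W^l is (X d/dX - q(l+1))
W^(l+1), which is diagonal on coefficients. -/
theorem coeff_eulerSeries_mul_pow (q : ℕ) (S : PowerSeries ℂ) (l n : ℕ) :
    ((l : ℂ) + 1) • coeff n (eulerSeries q S * linearSeries S ^ l) =
      ((n : ℂ) - q * (l + 1)) • coeff n (linearSeries S ^ (l + 1)) := by
  have h := coeff_X_mul_derivative (linearSeries S ^ (l + 1)) n
  rw [derivative_pow, Nat.add_sub_cancel] at h
  rw [sub_smul, ← h, ← coeff_complex_smul, ← coeff_complex_smul, ← map_sub, eulerSeries_eq]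
  congr 1
  have hs : ∀ (x : ℂ) (F : PowerSeries Fock), x • F = C (MvPolynomial.C x) * F := by
    intro x F
    ext1 n
    rw [coeff_complex_smul, coeff_C_mul, MvPolynomial.smul_eq_C_mul]
  simp only [hs]
  simp only [map_add, map_mul, map_natCast, map_one]
  push_cast
  ring

theorem coeff_mul_eq_sum_of_lt (U F : PowerSeries Fock) (k n N : ℕ) (hN : n < N)
    (hU : ∀ d < k, coeff d U = 0) :
    coeff (n + k) (U * F) = ∑ a ∈ range N, coeff (a + k) U * coeff n (X ^ a * F) := by
  obtain ⟨V, rfl⟩ := X_pow_dvd_iff.mpr hU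
  rw [mul_assoc, coeff_X_pow_mul, coeff_mul, Nat.sum_antidiagonal_eq_sum_range_succ_mk]
  have hsub : range n.succ ⊆ range N := range_subset_range.mpr hN
  rw [← sum_subset hsub]
  · refine sum_congr rfl fun a ha => ?_
    rw [coeff_X_pow_mul, coeff_X_pow_mul', if_pos (by simpa [Nat.lt_succ_iff] using ha)]
  · intro a _ ha
    rw [coeff_X_pow_mul' F, if_neg, mul_zero]
    simpa [Nat.lt_succ_iff] using ha

/-- One application of the cut-and-join operator, modulo terms of higher degree. -/
theorem cutJoin_coeff_linearSeries_pow_sub_mem (k ρ q : ℕ) (hk : 0 < k) (κ : ℂ) (hκ : κ ≠ 0)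
    (S : PowerSeries ℂ) (hS : constantCoeff S = 0)
    (hlow : ∀ d < k, d ≠ q → coeff d S = 0)
    (heq : ∀ a : ℕ, (κ / (ρ + 1)) * coeff a (S ^ (ρ + 1)) =
      ((a : ℂ) + k - q) * (coeff (a + k) S / (a + k))) (l n : ℕ) :
    ((((ρ + 1 : ℕ) : ℂ)⁻¹ • cutJoin k (ρ + 1)) (coeff n (linearSeries S ^ (l + 1 + ρ)))) -
      (((l + 1 + ρ)! : ℂ) / (l + 1)! * (((n : ℂ) + k - q * (l + 1)) / κ)) •
        coeff (n + k) (linearSeries S ^ (l + 1)) ∈ degGE (l + 1 + 1) := by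
  set W := linearSeries S with hW
  set f := coeff n (W ^ (l + 1 + ρ)) with hf
  have hfm : f ∈ degGE (l + 1 + ρ) := coeff_linearSeries_pow_mem S _ n
  obtain ⟨N, hN, hsum⟩ := cutJoin_apply_eq_sum k (ρ + 1) f (n + 1)
  have hρ : (ρ : ℂ) + 1 ≠ 0 := by exact_mod_cast Nat.succ_ne_zero ρ
  have hl : (l : ℂ) + 1 ≠ 0 := by exact_mod_cast Nat.succ_ne_zero l
  have hlf : (l ! : ℂ) ≠ 0 := by exact_mod_cast Nat.factorial_ne_zero _
  -- Merging creates only parts of size at least k. If q < k, the initial term of S lies below this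
  -- bound, but the factor d - q removes it.
  have hU : ∀ d < k, coeff d (eulerSeries q S) = 0 := by
    intro d hd
    rw [eulerSeries, coeff_mk]
    by_cases h : d = q
    · simp [h]
    · simp [hlow d hd h]
  have hdesc : ((l + 1 + ρ).descFactorial (ρ + 1) : ℂ) = ((l + 1 + ρ)! : ℂ) / l ! := by
    rw [eq_div_iff hlf, mul_comm]
    have := Nat.factorial_mul_descFactorial (n := l + 1 + ρ) (k := ρ + 1) (by omega)
    rw [show l + 1 + ρ - (ρ + 1) = l by omega] at this
    exact_mod_cast this
  have hlead : ((ρ + 1 : ℕ) : ℂ)⁻¹ • ∑ a ∈ range N, ∑ d : Composition a with d.length = ρ + 1,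
      J (-((a + k : ℕ) : ℤ)) (annih d f) =
      (((l + 1 + ρ)! : ℂ) / (l + 1)! * (((n : ℂ) + k - q * (l + 1)) / κ)) •
        coeff (n + k) (W ^ (l + 1)) := by
    -- The equation for S turns [X^a] S^(ρ+1), the weight of a merge, into the coefficient at a + k
    -- of the Euler series; the sum over a is then a Cauchy product.
    have h1 : ∀ a, ((ρ + 1 : ℕ) : ℂ)⁻¹ • ∑ d : Composition a with d.length = ρ + 1,
        J (-((a + k : ℕ) : ℤ)) (annih d f) =
        (((l + 1 + ρ)! : ℂ) / l ! / κ) • (coeff (a + k) (eulerSeries q S) *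
          coeff n (X ^ a * W ^ l)) := by
      intro a
      rw [← map_sum, hf, sum_annih_coeff_linearSeries_pow S hS, map_smul, J_neg_natCast_eq_mul,
        hdesc, eulerSeries, coeff_mk, smul_mul_assoc, smul_smul, smul_smul,
        show l + 1 + ρ - (ρ + 1) = l by omega]
      congr 1
      have h := heq a
      push_cast
      rw [← h]
      field_simp
    rw [smul_sum, sum_congr rfl fun a _ => h1 a, ← smul_sum,
      ← coeff_mul_eq_sum_of_lt _ _ k n N hN hU]
    have h2 := coeff_eulerSeries_mul_pow q S l (n + k)
    rw [← hW] at h2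
    rw [← inv_smul_smul₀ hl (coeff (n + k) (eulerSeries q S * W ^ l)), h2, smul_smul, smul_smul,
      Nat.factorial_succ l]
    congr 1
    push_cast
    field_simp
  rw [← hlead, LinearMap.smul_apply, hsum, ← smul_sub, ← sum_sub_distrib]
  refine smul_mem_degGE _ (sum_mem fun a _ => ?_)
  have := cutJoinPart_sub_mem k ρ a hk hfm
  rwa [show l + 1 + ρ - ρ + 1 = l + 1 + 1 by omega] at this

theorem coeff_linearSeries_pow_lowest (S : PowerSeries ℂ) (q : ℕ) (hq : 0 < q)
    (hlow : ∀ d < q, coeff d S = 0) (hS : coeff q S = q) (n : ℕ) :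
    coeff (q * n) (linearSeries S ^ n) = J (-(q : ℤ)) 1 ^ n := by
  have hq' : (q : ℂ) ≠ 0 := by exact_mod_cast hq.ne'
  have hl : ∀ d < q, coeff d (linearSeries S) = 0 := by
    intro d hd
    rw [coeff_linearSeries, hlow d hd, zero_div, zero_smul]
  have h1 : coeff q (linearSeries S) = J (-(q : ℤ)) 1 := by
    rw [coeff_linearSeries, hS, div_self hq', one_smul]
  obtain ⟨V, hV⟩ := X_pow_dvd_iff.mpr hl
  have hX : ∀ (d : ℕ) (F : PowerSeries Fock), coeff d (X ^ d * F) = constantCoeff F := by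
    intro d F
    simpa using coeff_X_pow_mul F d 0
  rw [hV, hX] at h1
  rw [hV, mul_pow, ← pow_mul, hX, ← h1, map_pow]

/-! ### Iteration and the vacuum expectation value -/

theorem cutJoin_pow_sub_mem (k ρ q : ℕ) (hk : 0 < k) (hq : 0 < q) (h : q * ρ + k ≠ 0) (j : ℕ) :
    ∀ l : ℕ, ((((ρ + 1 : ℕ) : ℂ)⁻¹ • cutJoin k (ρ + 1)) ^ j)
        (J (-(q : ℤ)) 1 ^ (l + 1 + ρ * j)) -
      (((l + 1 + ρ * j)! : ℂ) * j ! / (l + 1)!) •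
        coeff (q * (l + 1) + (q * ρ + k) * j) (linearSeries (treeSeries ρ k q h) ^ (l + 1)) ∈
      degGE (l + 1 + 1) := by
  set S := treeSeries ρ k q h with hS
  have hlow : ∀ d < q, coeff d S = 0 := fun d hd =>
    coeff_treeSeries_eq_zero ρ k q h d hd.ne (Or.inr hd)
  have hSq : coeff q S = q := by
    have := coeff_treeSeries ρ k q h 0
    simpa [hagenRothe_zero] using this
  have hκ : (((q * ρ + k : ℕ)) : ℂ) ≠ 0 := by exact_mod_cast h
  induction j with
  | zero =>
    intro l
    have hlf : ((l + 1)! : ℂ) ≠ 0 := by exact_mod_cast Nat.factorial_ne_zero _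
    simp only [mul_zero, add_zero, pow_zero, Module.End.one_apply, Nat.factorial_zero,
      Nat.cast_one, mul_one, div_self hlf, one_smul]
    rw [coeff_linearSeries_pow_lowest S q hq hlow hSq, sub_self]
    exact zero_mem _
  | succ j ih =>
    intro l
    -- The last merge goes from degree l + 1 + ρ to l + 1, so the first j merges are taken at l + ρ.
    -- The error terms also lose at most ρ degrees, hence stay in degree at least l + 2.
    have h1 := ih (l + ρ)
    set T := (((ρ + 1 : ℕ) : ℂ)⁻¹ • cutJoin k (ρ + 1)) with hT
    have e1 : l + ρ + 1 + ρ * j = l + 1 + ρ * (j + 1) := by ring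
    have e2 : l + ρ + 1 = l + 1 + ρ := by ring
    rw [e1, e2] at h1
    have h2 := cutJoin_coeff_linearSeries_pow_sub_mem k ρ q hk _ hκ S
      (by rw [← coeff_zero_eq_constantCoeff]; exact hlow 0 hq)
      (fun d hd hdq => coeff_treeSeries_eq_zero ρ k q h d hdq (Or.inl hd))
      (treeSeries_equation ρ k q hk h) l (q * (l + 1 + ρ) + (q * ρ + k) * j)
    rw [← hT] at h2
    have h3 : T ((T ^ j) (J (-(q : ℤ)) 1 ^ (l + 1 + ρ * (j + 1))) -
      (((l + 1 + ρ * (j + 1))! : ℂ) * j ! / (l + 1 + ρ)!) •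
        coeff (q * (l + 1 + ρ) + (q * ρ + k) * j) (linearSeries S ^ (l + 1 + ρ))) ∈
        degGE (l + 1 + 1) := by
      have := smul_mem_degGE (((ρ + 1 : ℕ) : ℂ)⁻¹) (cutJoin_mem k ρ hk h1)
      rwa [show l + 1 + ρ + 1 - ρ = l + 1 + 1 by omega] at this
    have h4 := add_mem h3 (smul_mem_degGE
      (((l + 1 + ρ * (j + 1))! : ℂ) * j ! / (l + 1 + ρ)!) h2)
    rw [map_sub, map_smul, smul_sub, sub_add_sub_cancel, smul_smul,
      show q * (l + 1 + ρ) + (q * ρ + k) * j + k = q * (l + 1) + (q * ρ + k) * (j + 1) by ring] at h4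
    rw [pow_succ', Module.End.mul_apply]
    convert h4 using 3
    have hf1 : ((l + 1 + ρ)! : ℂ) ≠ 0 := by exact_mod_cast Nat.factorial_ne_zero _
    have hf2 : ((l + 1)! : ℂ) ≠ 0 := by exact_mod_cast Nat.factorial_ne_zero _
    -- The Euler eigenvalue is κ(j + 1): dividing by κ leaves the factor that builds (j+1)!, while
    -- the other factorials telescope.
    have hn : ((q * (l + 1 + ρ) + (q * ρ + k) * j : ℕ) : ℂ) + k - q * (l + 1) =
        ((q * ρ + k : ℕ) : ℂ) * (j + 1) := by push_cast; ring
    rw [hn, mul_div_cancel_left₀ _ hκ, Nat.factorial_succ j]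
    push_cast
    field_simp

theorem prod_replicate_J_neg_natCast (q n : ℕ) :
    ((List.replicate n q).map fun a : ℕ => J (-(a : ℤ))).prod 1 = J (-(q : ℤ)) 1 ^ n := by
  induction n with
  | zero => rfl
  | succ n ih =>
    rw [List.replicate_succ, List.map_cons, List.prod_cons, Module.End.mul_apply, ih,
      J_neg_natCast_eq_mul, pow_succ']

theorem autCard_singleton (m : ℕ) : autCard [m] = 1 := by
  simp [autCard]

theorem autCard_replicate (n q : ℕ) : autCard (List.replicate (n + 1) q) = (n + 1)! := by
  rw [autCard, List.toFinset_replicate_of_ne_zero (Nat.succ_ne_zero n)]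
  simp

theorem constantCoeff_eq_zero_of_mem {f : Fock} (hf : f ∈ degGE 1) :
    MvPolynomial.constantCoeff f = 0 := by
  rw [MvPolynomial.mem_pow_idealOfVars_iff'] at hf
  exact hf 0 (by simp)

theorem leakyHurwitz_genus_zero_one_part (k ρ q b m : ℕ) (hk : 0 < k) (hq : 0 < q)
    (hm : m = q + (q * ρ + k) * b) :
    leakyHurwitz k (ρ + 1) b [m] (List.replicate (ρ * b + 1) q) =
      (b ! : ℂ) / m * (((k : ℂ) / (ρ + 1)) ^ b *
        hagenRothe ((q * (ρ + 1) / k + 1) * ρ) b (q * (ρ + 1) / k + 1)) := by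
  have h : q * ρ + k ≠ 0 := by omega
  have hm0 : 0 < m := by omega
  set S := treeSeries ρ k q h with hS
  have hmem := cutJoin_pow_sub_mem k ρ q hk hq h b 0
  rw [← hS, zero_add, pow_one, mul_one, ← hm, coeff_linearSeries, smul_smul] at hmem
  have hvev : vev (([m].map fun a : ℕ => J (a : ℤ)).prod *
      (((ρ + 1 : ℕ) : ℂ)⁻¹ • cutJoin k (ρ + 1)) ^ b *
        ((List.replicate (ρ * b + 1) q).map fun a : ℕ => J (-(a : ℤ))).prod) =
      ((ρ * b + 1)! : ℂ) * b ! * coeff m S := by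
    -- The error has degree at least 2, so it still has no constant term after J_m.
    have h0 := constantCoeff_eq_zero_of_mem (J_natCast_mem m hmem)
    rw [map_sub, map_smul, J_natCast_J_neg_natCast_one m m hm0, if_pos rfl, map_sub, sub_eq_zero,
      MvPolynomial.smul_eq_C_mul, ← MvPolynomial.C_mul, MvPolynomial.constantCoeff_C] at h0
    have hmc : (m : ℂ) ≠ 0 := by exact_mod_cast hm0.ne'
    rw [vev, Module.End.mul_apply, Module.End.mul_apply, prod_replicate_J_neg_natCast,
      List.map_singleton, List.prod_singleton, add_comm (ρ * b) 1, h0]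
    simp only [Nat.factorial_one, Nat.cast_one, div_one]
    field_simp
  rw [leakyHurwitz, hvev, autCard_singleton, autCard_replicate, List.prod_singleton,
    List.prod_replicate, hS, hm, coeff_treeSeries, ← hm]
  have hq' : (q : ℂ) ≠ 0 := by exact_mod_cast hq.ne'
  have hf : ((ρ * b + 1)! : ℂ) ≠ 0 := by exact_mod_cast Nat.factorial_ne_zero _
  rw [mul_pow, ← pow_mul]
  push_cast
  rw [pow_succ (q : ℂ)]
  field_simp

theorem orbifoldLeakyHurwitz_eq (k ρ q b m : ℕ) (hk : 0 < k) (hq : 0 < q)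
    (hm : m = q + (q * ρ + k) * b) :
    orbifoldLeakyHurwitz k (ρ + 1) q 0 [m] =
      leakyHurwitz k (ρ + 1) b [m] (List.replicate (ρ * b + 1) q) := by
  rw [orbifoldLeakyHurwitz, sum_eq_single (b, ρ * b + 1)]
  · rintro ⟨s, n⟩ hx hne
    exfalso
    simp only [mem_filter, List.sum_singleton, List.length_singleton] at hx
    obtain ⟨-, h1, h2⟩ := hx
    -- Riemann–Hurwitz in genus zero fixes n; the size condition then reads m = q + κs and fixes s.
    have hn : n = ρ * s + 1 := by
      zify; push_cast at h1; linarith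
    subst hn
    have : (q * ρ + k) * s = (q * ρ + k) * b := by
      rw [hm] at h2; linarith
    have := Nat.eq_of_mul_eq_mul_left (by omega) this
    subst this
    exact hne rfl
  · intro hnot
    refine absurd ?_ hnot
    simp only [mem_filter, mem_product, mem_range, List.sum_singleton, List.length_singleton]
    refine ⟨⟨?_, ?_⟩, ?_, ?_⟩
    · rw [hm]; nlinarith [Nat.zero_le (q * ρ * b)]
    · rw [hm]
      have : ρ * b ≤ q * ρ * b := Nat.mul_le_mul_right _ (Nat.le_mul_of_pos_left _ hq)
      rw [add_mul]
      omega
    · push_cast; ring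
    · rw [hm]; ring

theorem exists_of_orbifoldLeakyHurwitz_ne_zero (k ρ q m : ℕ)
    (h : orbifoldLeakyHurwitz k (ρ + 1) q 0 [m] ≠ 0) : ∃ b, m = q + (q * ρ + k) * b := by
  obtain ⟨⟨s, n⟩, hx, -⟩ := exists_ne_zero_of_sum_ne_zero h
  simp only [mem_filter, List.sum_singleton, List.length_singleton] at hx
  obtain ⟨-, h1, h2⟩ := hx
  have hn : n = ρ * s + 1 := by
    zify; push_cast at h1; linarith
  exact ⟨s, by rw [h2, hn]; ring⟩

theorem div_eq_natCast_iff (k ρ q b m : ℕ) (hk : 0 < k) :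
    ((m : ℚ) - q) / (q * (((ρ + 1 : ℕ) : ℚ) - 1) + k) = b ↔ m = q + (q * ρ + k) * b := by
  have hk' : (0 : ℚ) < k := by exact_mod_cast hk
  have hne : (q : ℚ) * (((ρ + 1 : ℕ) : ℚ) - 1) + k ≠ 0 := by
    push_cast; rw [add_sub_cancel_right]; positivity
  rw [div_eq_iff hne, ← Nat.cast_inj (R := ℚ)]
  push_cast
  constructor <;> intro h <;> linarith

theorem hagenRothe_ne_zero (x z : ℝ) (hx : 0 < x) (hz : 0 ≤ z) (n : ℕ) :
    hagenRothe z n x ≠ 0 := by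
  obtain _ | n := n
  · exact one_ne_zero
  · rw [hagenRothe]
    refine div_ne_zero (mul_ne_zero (by exact_mod_cast hx.ne') (prod_ne_zero_iff.mpr ?_))
      (by exact_mod_cast Nat.factorial_ne_zero _)
    intro i _
    have : 0 < x + (n + 1) * z + (i + 1) := by positivity
    exact_mod_cast this.ne'

end LeakyHurwitz

theorem mainTheorem4 (r k m q : ℕ) (hr : 0 < r) (hk : 0 < k) (hm : 0 < m) (hq : 0 < q) :
    (LeakyHurwitz.orbifoldLeakyHurwitz k r q 0 [m] ≠ 0 ↔
      ∃ b : ℕ, ((m : ℚ) - q) / (q * ((r : ℚ) - 1) + k) = b) ∧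
    ∀ b : ℕ, ((m : ℚ) - q) / (q * ((r : ℚ) - 1) + k) = b →
      ∀ A : ℂ, A = (k : ℂ) / r →
        LeakyHurwitz.orbifoldLeakyHurwitz k r q 0 [m] =
          (Nat.factorial b : ℂ) / ((m : ℂ) * ((b : ℂ) * ((r : ℂ) - 1) + 1)) *
            Ring.choose ((m : ℂ) / A) b * A ^ b := by
  obtain ⟨ρ, rfl⟩ : ∃ ρ, r = ρ + 1 := ⟨r - 1, by omega⟩
  have hkc : (k : ℂ) ≠ 0 := by exact_mod_cast hk.ne'
  have hmc : (m : ℂ) ≠ 0 := by exact_mod_cast hm.ne'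
  have hρ : (ρ : ℂ) + 1 ≠ 0 := by exact_mod_cast Nat.succ_ne_zero ρ
  simp only [LeakyHurwitz.div_eq_natCast_iff k ρ q _ m hk]
  refine ⟨⟨LeakyHurwitz.exists_of_orbifoldLeakyHurwitz_ne_zero k ρ q m, ?_⟩, ?_⟩
  · rintro ⟨b, hb⟩
    rw [LeakyHurwitz.orbifoldLeakyHurwitz_eq k ρ q b m hk hq hb,
      LeakyHurwitz.leakyHurwitz_genus_zero_one_part k ρ q b m hk hq hb]
    have hne := LeakyHurwitz.hagenRothe_ne_zero ((q : ℝ) * (ρ + 1) / k + 1)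
      (((q : ℝ) * (ρ + 1) / k + 1) * ρ) (by positivity) (by positivity) b
    push_cast at hne
    refine mul_ne_zero (div_ne_zero (by exact_mod_cast Nat.factorial_ne_zero _) hmc)
      (mul_ne_zero (pow_ne_zero _ (div_ne_zero hkc hρ)) hne)
  · rintro b hb A rfl
    rw [LeakyHurwitz.orbifoldLeakyHurwitz_eq k ρ q b m hk hq hb,
      LeakyHurwitz.leakyHurwitz_genus_zero_one_part k ρ q b m hk hq hb]
    have hbρ : (b : ℂ) * ρ + 1 ≠ 0 := by exact_mod_cast Nat.succ_ne_zero (b * ρ)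
    -- This puts m/A in the form N + b - 1 with N = g(bρ + 1), where the binomial coefficient is a
    -- rising factorial of N over b!. The resulting factor bρ + 1 cancels the denominator b(r-1) +
    -- 1.
    have hmA : (m : ℂ) / ((k : ℂ) / ((ρ + 1 : ℕ) : ℂ)) =
        ((q : ℂ) * (ρ + 1) / k + 1) * (b * ρ + 1) + b - 1 := by
      rw [hb]; push_cast; field_simp; ring
    rw [hmA, LeakyHurwitz.mul_choose_eq_hagenRothe]
    push_cast
    rw [add_sub_cancel_right]
    rw [mul_comm] at hbρ
    generalize LeakyHurwitz.hagenRothe _ b _ = R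
    field_simp
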